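/- A labelled Markov process (LMP) with label set $L$ is a structure $\mathbf S=(S,\Sigma,\{\tau_a : a\in L\})$ where $(S,\Sigma)$ is a measurable space and, for each $a\in L$, $\tau_a : S\times\Sigma\to[0,1]$ is such that $\tau_a(s,\cdot)$ is a measure (of total mass at most $1$) for each $s\in S$ and $\tau_a(\cdot,Q)$ is $\Sigma$-measurable for each $Q\in\Sigma$. A zigzag morphism $f:\mathbf S\to\mathbf S'$ between LMP with the same label set is a surjective measurable map $f:(S,\Sigma)\to(S',\Sigma')$ with $\tau_a(s,f^{-1}(Q))=\tau'_a(f(s),Q)$ for all $a\in L$, $s\in S$, $Q\in\Sigma'$. A metric space is coanalytic if it is homeomorphic to the complement of an analytic subset of a Polish space, and a measurable space is coanalytic if it is isomorphic to the Borel space of a coanalytic metric space. Let $L$ be an arbitrary set, and consider the category whose objects are the LMP with label set $L$ whose state spaces are coanalytic measurable spaces, and whose morphisms are the zigzag morphisms. **Corollary.** This category has semipullbacks: for every cospan $\mathbf S_1\xrightarrow{h_1}\mathbf S_0\xleftarrow{h_2}\mathbf S_2$ in it there are an object $\mathbf S_3$ and morphisms $k_1:\mathbf S_3\to\mathbf S_1$,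 $k_2:\mathbf S_3\to\mathbf S_2$ of the category with $h_1\circ k_1=h_2\circ k_2$. In particular, any two objects $\mathbf S,\mathbf S'$ that are behaviorally equivalent in this category (there are an object $\mathbf U$ and morphisms $\mathbf S\to\mathbf U\leftarrow\mathbf S'$ of the category) are bisimilar in it (there are an object $\mathbf T$ and morphisms $\mathbf S\leftarrow\mathbf T\to\mathbf S'$ of the category). -/

import Mathlib

open CategoryTheory MeasureTheory ProbabilityTheory

universe u v w

/-- A labelled Markov process with label set `L`: a measurable space together with, for each label,
a subprobability kernel from the space to itself. Measurability of `s ↦ τ a s Q` for each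
measurable `Q` is part of `Kernel`. -/
structure LMP (L : Type v) : Type (max (u + 1) v) where
  State : Type u
  [measurableSpace : MeasurableSpace State]
  τ : L → Kernel State State
  le_one : ∀ (a : L) (s : State), τ a s Set.univ ≤ 1

attribute [instance] LMP.measurableSpace

namespace LMP

/-- Zigzag morphisms: surjective measurable maps that preserve the transition measures. -/
@[ext]
structure Zigzag {L : Type v} (S T : LMP.{u, v} L) : Type u where
  toFun : S.State → T.State
  measurable : Measurable toFun
  surjective : Function.Surjective toFun
  zigzag : ∀ (a : L) (s : S.State) (Q : Set T.State), MeasurableSet Q →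
    S.τ a s (toFun ⁻¹' Q) = T.τ a (toFun s) Q

/-- Labelled Markov processes with label set `L` and zigzag morphisms form a category. -/
instance {L : Type v} : Category (LMP.{u, v} L) where
  Hom S T := Zigzag S T
  id S := ⟨id, measurable_id, Function.surjective_id, fun _ _ _ _ => rfl⟩
  comp f g := ⟨g.toFun ∘ f.toFun, g.measurable.comp f.measurable,
    g.surjective.comp f.surjective, fun a s Q hQ => by
      rw [Set.preimage_comp, f.zigzag a s _ (g.measurable hQ), g.zigzag a _ Q hQ]
      rfl⟩

end LMP

/-- A topological space is coanalytic if it is homeomorphic to the complement of an analytic subset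
of a Polish space. -/
def IsCoanalyticSpace (M : Type u) [TopologicalSpace M] : Prop :=
  ∃ (Y : Type u) (_ : TopologicalSpace Y) (_ : PolishSpace Y) (A : Set Y),
    AnalyticSet A ∧ Nonempty (M ≃ₜ (Aᶜ : Set Y))

/-- A measurable space is coanalytic if it is isomorphic to the Borel space of a coanalytic
metric space. -/
def IsCoanalyticMeasurableSpace (S : Type u) [MeasurableSpace S] : Prop :=
  ∃ (M : Type u) (_ : MetricSpace M) (_ : MeasurableSpace M) (_ : BorelSpace M),
    IsCoanalyticSpace M ∧ Nonempty (S ≃ᵐ M)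

/-- The property of a labelled Markov process that its state space is coanalytic. -/
def LMP.isCoanalytic (L : Type v) : ObjectProperty (LMP.{u, v} L) :=
  fun S => IsCoanalyticMeasurableSpace S.State

/-- The category of labelled Markov processes over coanalytic measurable spaces, with all zigzag
morphisms between them. -/
abbrev CoanalyticLMP (L : Type v) : Type (max (u + 1) v) :=
  (LMP.isCoanalytic.{u, v} L).FullSubcategory

/-- A category has semipullbacks if every cospan can be completed to a commutative square. -/
def HasSemipullbacks (C : Type w) [Category.{v} C] : Prop :=
  ∀ (S₁ S₀ S₂ : C) (h₁ : S₁ ⟶ S₀) (h₂ : S₂ ⟶ S₀),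
    ∃ (S₃ : C) (k₁ : S₃ ⟶ S₁) (k₂ : S₃ ⟶ S₂), k₁ ≫ h₁ = k₂ ≫ h₂

/-- Two objects of a category are bisimilar if they are the two ends of a span. -/
def Bisimilar {C : Type w} [Category.{v} C] (S S' : C) : Prop :=
  ∃ T : C, Nonempty (T ⟶ S) ∧ Nonempty (T ⟶ S')

/-- Two objects of a category are behaviorally equivalent if they are the two ends of a cospan. -/
def BehaviorallyEquivalent {C : Type w} [Category.{v} C] (S S' : C) : Prop :=
  ∃ U : C, Nonempty (S ⟶ U) ∧ Nonempty (S' ⟶ U)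

/-! The semipullback lives on the fibre product of the state spaces. Each state space embeds in a
Polish space `Yᵢ` with coanalytic range, and `h₁`, `h₂` extend to Borel maps `H₁ : Y₁ → Y₀`, `H₂ :
Y₂ → Y₀`. At a point of the fibre product, the zigzag condition gives the two pushed-forward
transition measures the same image in `Y₀`. Disintegrating both over `Y₀` and making them
conditionally independent yields a coupling, measurable in the point and carried by `{H₁ = H₂}`
(`exists_coupling_of_map_eq`).

Coanalyticity brings the coupling back to the fibre product: a compact subset of `(range eᵢ)ᶜ` has
empty preimage, so by inner regularity on analytic sets the marginals do not charge that complement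
(`measure_map_eq_zero`). The coupling then lifts through the embedding (`exists_lift`). -/

open Set Filter Topology

/-! ### Measures on analytic sets and coanalytic spaces -/

/-- Inner regularity of finite measures on analytic sets. -/
theorem MeasureTheory.AnalyticSet.exists_isCompact_le_measure {α : Type*} [TopologicalSpace α]
    [TopologicalSpace.MetrizableSpace α] [MeasurableSpace α] [BorelSpace α] (μ : Measure α)
    [IsFiniteMeasure μ] {A : Set α} (hA : AnalyticSet A) {c : ENNReal} (hc : c < μ A) :
    ∃ K ⊆ A, IsCompact K ∧ c ≤ μ K := by
  let := TopologicalSpace.metrizableSpaceMetric α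
  rw [AnalyticSet] at hA
  obtain rfl | ⟨f, hf, rfl⟩ := hA
  · simp at hc
  -- Continuity from below along increasing sequences holds for arbitrary sets, so the images need
  -- not be measurable.
  have step : ∀ (s : {s : Set (ℕ → ℕ) // c < μ (f '' s)}) (n : ℕ),
      ∃ m : ℕ, c < μ (f '' (s.1 ∩ {x | x n ≤ m})) := by
    rintro ⟨s, hs⟩ n
    have hU : f '' s = ⋃ m : ℕ, f '' (s ∩ {x | x n ≤ m}) := by
      rw [← image_iUnion, ← inter_iUnion]
      congr 1
      ext x
      simpa using fun _ => ⟨x n, le_rfl⟩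
    have hmono : Monotone fun m : ℕ => f '' (s ∩ {x | x n ≤ m}) := fun i j hij =>
      image_mono (inter_subset_inter_right _ fun x (hx : x n ≤ i) => hx.trans hij)
    rw [hU, hmono.measure_iUnion] at hs
    exact lt_iSup_iff.1 hs
  choose m hm using step
  let F : ℕ → {s : Set (ℕ → ℕ) // c < μ (f '' s)} := fun n =>
    Nat.rec ⟨univ, by simpa using hc⟩ (fun n s => ⟨s.1 ∩ {x | x n ≤ m s n}, hm s n⟩) n
  let b : ℕ → ℕ := fun n => m (F n) n
  have hF : ∀ n, ∀ x ∈ (F n).1, ∀ k < n, x k ≤ b k := by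
    intro n
    induction n with
    | zero => simp
    | succ n ih =>
      intro x hx k hk
      obtain ⟨h1, h2⟩ : x ∈ (F n).1 ∩ {x | x n ≤ b n} := hx
      obtain hk | rfl := Nat.lt_succ_iff_lt_or_eq.1 hk
      · exact ih x h1 k hk
      · exact h2
  have hK : IsCompact (Icc 0 b) := isCompact_Icc
  refine ⟨f '' Icc 0 b, image_subset_range _ _, hK.image hf, ?_⟩
  -- By outer regularity it suffices that every open `U` containing the compact image contains some
  -- `f '' (F n).1`, whose measure exceeds `c`.
  rw [Set.measure_eq_iInf_isOpen]
  refine le_iInf₂ fun U hU => le_iInf fun hUo => ?_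
  suffices h : ∃ n, f '' (F n).1 ⊆ U by
    obtain ⟨n, hn⟩ := h
    exact (F n).2.le.trans (measure_mono hn)
  by_contra! h
  have h' : ∀ n, ∃ x ∈ (F n).1, f x ∉ U := fun n => by
    obtain ⟨_, ⟨x, hx, rfl⟩, hxU⟩ := not_subset.1 (h n)
    exact ⟨x, hx, hxU⟩
  choose x hxF hxU using h'
  -- Truncating by `b` moves `x n` into the compact box without changing its coordinates below `n`,
  -- so the limit is also that of the untruncated subsequence.
  obtain ⟨y, hy, φ, hφ, hlim⟩ := hK.tendsto_subseq (x := fun n => x n ⊓ b)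
    fun n => ⟨fun _ => Nat.zero_le _, inf_le_right⟩
  have hx : Tendsto (x ∘ φ) atTop (𝓝 y) := by
    rw [tendsto_pi_nhds] at hlim ⊢
    intro k
    refine (hlim k).congr' ?_
    filter_upwards [eventually_gt_atTop k] with n hn
    exact inf_eq_left.2 (hF _ _ (hxF _) k (hn.trans_le hφ.le_apply))
  have hfx := (hf.tendsto y).comp hx
  obtain ⟨n, hn⟩ := (hfx.eventually (hUo.mem_nhds (hU (mem_image_of_mem f hy)))).exists
  exact hxU _ hn

/-- A finite image measure does not charge an analytic set disjoint from the range. -/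
theorem MeasureTheory.AnalyticSet.measure_map_eq_zero {S α : Type*} [MeasurableSpace S]
    [TopologicalSpace α] [TopologicalSpace.MetrizableSpace α] [MeasurableSpace α] [BorelSpace α]
    {e : S → α} (he : Measurable e) (μ : Measure S) [IsFiniteMeasure μ] {A : Set α}
    (hA : AnalyticSet A) (hd : Disjoint (range e) A) : μ.map e A = 0 := by
  by_contra h
  obtain ⟨c, hc0, hc⟩ := exists_between (pos_iff_ne_zero.2 h)
  obtain ⟨K, hKA, hK, hcK⟩ := hA.exists_isCompact_le_measure _ hc
  rw [Measure.map_apply he hK.measurableSet,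
    preimage_eq_empty (hd.symm.mono_left hKA), measure_empty] at hcK
  exact (hc0.trans_le hcK).false

/-- An injection that induces the σ-algebra is the form suited to extending maps, pushing measures
forward and taking products. Conversely, `range e` with the subspace topology serves as the
coanalytic metric space. -/
theorem isCoanalyticMeasurableSpace_iff {S : Type u} [mS : MeasurableSpace S] :
    IsCoanalyticMeasurableSpace S ↔ ∃ (Y : Type u) (_ : TopologicalSpace Y) (_ : PolishSpace Y)
      (mY : MeasurableSpace Y) (_ : BorelSpace Y) (e : S → Y),
        Function.Injective e ∧ mS = mY.comap e ∧ AnalyticSet (range e)ᶜ := by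
  constructor
  · rintro ⟨M, _, _, _, ⟨Y, _, _, A, hA, ⟨φ⟩⟩, ⟨ψ⟩⟩
    borelize Y
    let χ : S ≃ᵐ (Aᶜ : Set Y) := ψ.trans φ.toMeasurableEquiv
    refine ⟨Y, inferInstance, inferInstance, inferInstance, inferInstance, fun s => (χ s : Y),
      Subtype.val_injective.comp χ.injective, ?_, ?_⟩
    · exact χ.measurableEmbedding.comap_eq.symm.trans MeasurableSpace.comap_comp
    · have : range (fun s => (χ s : Y)) = Aᶜ := by
        rw [← Function.comp_def, χ.surjective.range_comp, Subtype.range_coe]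
      rwa [this, compl_compl]
  · rintro ⟨Y, _, _, mY, _, e, he, hm, hA⟩
    let := TopologicalSpace.metrizableSpaceMetric Y
    refine ⟨range e, inferInstance, inferInstance, inferInstance,
      ⟨Y, inferInstance, inferInstance, (range e)ᶜ, hA, ⟨.setCongr (compl_compl _).symm⟩⟩, ⟨?_⟩⟩
    refine ⟨Equiv.ofInjective e he, ?_, ?_⟩
    · refine Measurable.subtype_mk ?_
      rw [hm]
      exact comap_measurable e
    · intro s hs
      rw [hm] at hs
      obtain ⟨t, ht, rfl⟩ := hs
      refine ⟨t, ht, ?_⟩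
      ext y
      simp [Equiv.apply_ofInjective_symm]

/-! ### Gluing and lifting kernels -/

namespace ProbabilityTheory.Kernel

/-- Two finite kernels with a common first marginal can be glued along it. -/
theorem exists_glue {X Z₀ Z₁ Z₂ : Type*} [MeasurableSpace X] [MeasurableSpace Z₀]
    [MeasurableSpace.CountablyGenerated Z₀] [MeasurableSpace Z₁] [StandardBorelSpace Z₁]
    [Nonempty Z₁] [MeasurableSpace Z₂] [StandardBorelSpace Z₂] [Nonempty Z₂]
    (κ₁ : Kernel X (Z₀ × Z₁)) (κ₂ : Kernel X (Z₀ × Z₂)) [IsFiniteKernel κ₁] [IsFiniteKernel κ₂]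
    (h : fst κ₁ = fst κ₂) :
    ∃ ρ : Kernel X (Z₀ × Z₁ × Z₂),
      (ρ.map fun p => (p.1, p.2.1)) = κ₁ ∧ (ρ.map fun p => (p.1, p.2.2)) = κ₂ := by
  -- Given the common coordinate, the other two are drawn independently from the two conditional
  -- kernels.
  refine ⟨fst κ₁ ⊗ₖ (condKernel κ₁ ×ₖ condKernel κ₂), ?_, ?_⟩
  · conv_rhs => rw [← κ₁.disintegrate κ₁.condKernel]
    ext x s hs
    rw [map_apply' _ (by fun_prop) _ hs, compProd_apply (by measurability), compProd_apply hs]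
    refine lintegral_congr fun w => ?_
    have hw : MeasurableSet (Prod.mk w ⁻¹' s) := measurable_prodMk_left hs
    conv_rhs => rw [← fst_prod κ₁.condKernel κ₂.condKernel, fst_apply' _ _ hw]
    rfl
  · conv_rhs => rw [← κ₂.disintegrate κ₂.condKernel, ← h]
    ext x s hs
    rw [map_apply' _ (by fun_prop) _ hs, compProd_apply (by measurability), compProd_apply hs]
    refine lintegral_congr fun w => ?_
    have hw : MeasurableSet (Prod.mk w ⁻¹' s) := measurable_prodMk_left hs
    conv_rhs => rw [← snd_prod κ₁.condKernel κ₂.condKernel, snd_apply' _ _ hw]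
    rfl

/-- A kernel concentrated on the range of an injection that induces the σ-algebra of its domain
lifts to that domain. -/
theorem exists_lift {X T Y : Type*} [MeasurableSpace X] [mT : MeasurableSpace T]
    [mY : MeasurableSpace Y] {e : T → Y} (he : Function.Injective e) (hm : mT = mY.comap e)
    (ρ : Kernel X Y) (hρ : ∀ x, ∀ᵐ y ∂ρ x, y ∈ range e) :
    ∃ η : Kernel X T, ∀ x B, MeasurableSet B → η x (e ⁻¹' B) = ρ x B := by
  -- The range of `e` need not be measurable, but it is conull for each `ρ x`, which makes images
  -- null-measurable.
  have hn : ∀ x s, MeasurableSet s → NullMeasurableSet (e '' s) (ρ x) := by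
    intro x s hs
    rw [hm] at hs
    obtain ⟨B, hB, rfl⟩ := hs
    rw [image_preimage_eq_inter_range]
    exact hB.nullMeasurableSet.inter (NullMeasurableSet.of_compl (.of_null (hρ x)))
  have key : ∀ x B, MeasurableSet B → (ρ x).comap e (e ⁻¹' B) = ρ x B := by
    intro x B hB
    have hB' : MeasurableSet (e ⁻¹' B) := hm ▸ ⟨B, hB, rfl⟩
    rw [Measure.comap_apply₀ _ _ he (hn x) hB'.nullMeasurableSet, image_preimage_eq_inter_range]
    refine measure_congr ?_
    filter_upwards [hρ x] with y hy
    exact propext (and_iff_left hy)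
  refine ⟨⟨fun x => (ρ x).comap e, Measure.measurable_of_measurable_coe _ fun s hs => ?_⟩, key⟩
  rw [hm] at hs
  obtain ⟨B, hB, rfl⟩ := hs
  simp_rw [key _ B hB]
  exact ρ.measurable_coe hB

/-- Two finite kernels with the same image under `H₁` and `H₂` have a coupling concentrated on the
fibre product of `H₁` and `H₂`. -/
theorem exists_coupling_of_map_eq {X Y₀ Y₁ Y₂ : Type*} [MeasurableSpace X] [MeasurableSpace Y₀]
    [StandardBorelSpace Y₀] [MeasurableSpace Y₁] [StandardBorelSpace Y₁] [Nonempty Y₁]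
    [MeasurableSpace Y₂] [StandardBorelSpace Y₂] [Nonempty Y₂]
    (κ₁ : Kernel X Y₁) (κ₂ : Kernel X Y₂) [IsFiniteKernel κ₁] [IsFiniteKernel κ₂]
    {H₁ : Y₁ → Y₀} {H₂ : Y₂ → Y₀} (hH₁ : Measurable H₁) (hH₂ : Measurable H₂)
    (h : κ₁.map H₁ = κ₂.map H₂) :
    ∃ ρ : Kernel X (Y₁ × Y₂), ρ.map Prod.fst = κ₁ ∧ ρ.map Prod.snd = κ₂ ∧
      ∀ x, ∀ᵐ p ∂ρ x, H₁ p.1 = H₂ p.2 := by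
  -- Passing to graphs turns the common image into a common first marginal, along which the kernels
  -- can be glued.
  have m₁ : Measurable fun y => (H₁ y, y) := hH₁.prodMk measurable_id
  have m₂ : Measurable fun y => (H₂ y, y) := hH₂.prodMk measurable_id
  obtain ⟨ρ, h₁, h₂⟩ := exists_glue (κ₁.map fun y => (H₁ y, y)) (κ₂.map fun y => (H₂ y, y))
    (by rw [fst_eq, fst_eq, ← map_comp_right _ m₁ measurable_fst,
      ← map_comp_right _ m₂ measurable_fst]; exact h)
  refine ⟨ρ.map Prod.snd, ?_, ?_, fun x => ?_⟩
  · have := congrArg (fun κ => κ.map Prod.snd) h₁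
    simp only [← map_comp_right _ m₁ measurable_snd] at this
    rw [← map_comp_right _ (by fun_prop) (by fun_prop)] at this ⊢
    exact this.trans (map_id κ₁)
  · have := congrArg (fun κ => κ.map Prod.snd) h₂
    simp only [← map_comp_right _ m₂ measurable_snd] at this
    rw [← map_comp_right _ (by fun_prop) (by fun_prop)] at this ⊢
    exact this.trans (map_id κ₂)
  · have a₁ : ∀ᵐ q ∂ρ x, q.1 = H₁ q.2.1 := by
      have : ∀ᵐ q ∂(κ₁.map fun y => (H₁ y, y)) x, q.1 = H₁ q.2 := by
        rw [map_apply _ m₁, ae_map_iff m₁.aemeasurable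
          (measurableSet_eq_fun (f := fun q : Y₀ × Y₁ => q.1) (g := fun q => H₁ q.2)
            (by fun_prop) (by fun_prop))]
        simp
      rw [← h₁, map_apply _ (by fun_prop)] at this
      exact ae_of_ae_map (by fun_prop) this
    have a₂ : ∀ᵐ q ∂ρ x, q.1 = H₂ q.2.2 := by
      have : ∀ᵐ q ∂(κ₂.map fun y => (H₂ y, y)) x, q.1 = H₂ q.2 := by
        rw [map_apply _ m₂, ae_map_iff m₂.aemeasurable
          (measurableSet_eq_fun (f := fun q : Y₀ × Y₂ => q.1) (g := fun q => H₂ q.2)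
            (by fun_prop) (by fun_prop))]
        simp
      rw [← h₂, map_apply _ (by fun_prop)] at this
      exact ae_of_ae_map (by fun_prop) this
    rw [map_apply _ measurable_snd, ae_map_iff measurable_snd.aemeasurable (measurableSet_eq_fun
      (f := fun p : Y₁ × Y₂ => H₁ p.1) (g := fun p => H₂ p.2) (by fun_prop)
      (by fun_prop))]
    filter_upwards [a₁, a₂] with q hq₁ hq₂
    exact hq₁.symm.trans hq₂

end ProbabilityTheory.Kernel

/-! ### Semipullbacks of labelled Markov processes -/

namespace LMP

variable {L : Type v}

theorem Zigzag.map_τ {S T : LMP.{u, v} L} (f : Zigzag S T) (a : L) (s : S.State) :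
    (S.τ a s).map f.toFun = T.τ a (f.toFun s) := by
  ext Q hQ
  rw [Measure.map_apply f.measurable hQ, f.zigzag a s Q hQ]

instance (S : LMP.{u, v} L) (a : L) : IsFiniteKernel (S.τ a) :=
  ⟨1, ENNReal.one_lt_top, S.le_one a⟩

/-- The state space of the semipullback of a cospan: the fibre product of the state spaces. -/
abbrev FiberProd {S₁ S₀ S₂ : LMP.{u, v} L} (h₁ : Zigzag S₁ S₀) (h₂ : Zigzag S₂ S₀) : Type u :=
  {p : S₁.State × S₂.State // h₁.toFun p.1 = h₂.toFun p.2}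

theorem measurable_left {S₁ S₀ S₂ : LMP.{u, v} L} (h₁ : Zigzag S₁ S₀) (h₂ : Zigzag S₂ S₀) :
    Measurable fun t : FiberProd h₁ h₂ => t.1.1 := measurable_fst.comp measurable_subtype_coe

theorem measurable_right {S₁ S₀ S₂ : LMP.{u, v} L} (h₁ : Zigzag S₁ S₀) (h₂ : Zigzag S₂ S₀) :
    Measurable fun t : FiberProd h₁ h₂ => t.1.2 := measurable_snd.comp measurable_subtype_coe

theorem exists_semipullback {S₁ S₀ S₂ : LMP.{u, v} L} (c₁ : IsCoanalyticMeasurableSpace S₁.State)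
    (c₀ : IsCoanalyticMeasurableSpace S₀.State) (c₂ : IsCoanalyticMeasurableSpace S₂.State)
    (h₁ : Zigzag S₁ S₀) (h₂ : Zigzag S₂ S₀) :
    ∃ S₃ : LMP.{u, v} L, IsCoanalyticMeasurableSpace S₃.State ∧
      ∃ (k₁ : Zigzag S₃ S₁) (k₂ : Zigzag S₃ S₂),
        h₁.toFun ∘ k₁.toFun = h₂.toFun ∘ k₂.toFun := by
  obtain ⟨Y₁, _, _, _, _, e₁, inj₁, hm₁, hA₁⟩ := isCoanalyticMeasurableSpace_iff.1 c₁
  obtain ⟨Y₀, _, _, _, _, e₀, inj₀, hm₀, -⟩ := isCoanalyticMeasurableSpace_iff.1 c₀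
  obtain ⟨Y₂, _, _, _, _, e₂, inj₂, hm₂, hA₂⟩ := isCoanalyticMeasurableSpace_iff.1 c₂
  -- Disintegration and the extension of maps need nonempty target spaces, so the empty case is
  -- separate.
  obtain hS | ⟨⟨s₀⟩⟩ := isEmpty_or_nonempty S₀.State
  · have hS₁ : IsEmpty S₁.State := h₁.toFun.isEmpty
    have hS₂ : IsEmpty S₂.State := h₂.toFun.isEmpty
    exact ⟨S₁, c₁, ⟨id, measurable_id, Function.surjective_id, fun _ _ _ _ => rfl⟩,
      ⟨isEmptyElim, measurable_of_empty _, fun s => isEmptyElim s, fun _ s => isEmptyElim s⟩,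
      funext fun s => isEmptyElim s⟩
  have ne₀ : Nonempty Y₀ := ⟨e₀ s₀⟩
  have ne₁ : Nonempty Y₁ := ⟨e₁ (h₁.surjective s₀).choose⟩
  have ne₂ : Nonempty Y₂ := ⟨e₂ (h₂.surjective s₀).choose⟩
  have me₀ : Measurable e₀ := by rw [hm₀]; exact comap_measurable e₀
  have me₁ : Measurable e₁ := by rw [hm₁]; exact comap_measurable e₁
  have me₂ : Measurable e₂ := by rw [hm₂]; exact comap_measurable e₂
  obtain ⟨H₁, mH₁, hH₁⟩ : ∃ H : Y₁ → Y₀, Measurable H ∧ e₀ ∘ h₁.toFun = H ∘ e₁ :=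
    Measurable.exists_eq_measurable_comp (hm₁ ▸ me₀.comp h₁.measurable)
  obtain ⟨H₂, mH₂, hH₂⟩ : ∃ H : Y₂ → Y₀, Measurable H ∧ e₀ ∘ h₂.toFun = H ∘ e₂ :=
    Measurable.exists_eq_measurable_comp (hm₂ ▸ me₀.comp h₂.measurable)
  let e : FiberProd h₁ h₂ → Y₁ × Y₂ := fun t => (e₁ t.1.1, e₂ t.1.2)
  have inj : Function.Injective e := fun s t hst =>
    Subtype.ext (Prod.ext (inj₁ (Prod.ext_iff.1 hst).1) (inj₂ (Prod.ext_iff.1 hst).2))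
  have hm : (inferInstance : MeasurableSpace (FiberProd h₁ h₂)) =
      (inferInstance : MeasurableSpace (Y₁ × Y₂)).comap e := by
    refine le_antisymm ?_ (Measurable.comap_le
      ((me₁.comp (measurable_left h₁ h₂)).prodMk (me₂.comp (measurable_right h₁ h₂))))
    have i₁ : Measurable[MeasurableSpace.comap e inferInstance]
        fun t : FiberProd h₁ h₂ => t.1.1 := by
      rw [measurable_iff_comap_le, hm₁, MeasurableSpace.comap_comp, ← measurable_iff_comap_le]
      exact measurable_fst.comp (comap_measurable e)
    have i₂ : Measurable[MeasurableSpace.comap e inferInstance]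
        fun t : FiberProd h₁ h₂ => t.1.2 := by
      rw [measurable_iff_comap_le, hm₂, MeasurableSpace.comap_comp, ← measurable_iff_comap_le]
      exact measurable_snd.comp (comap_measurable e)
    exact measurable_iff_comap_le.1 (i₁.prodMk i₂)
  -- Injectivity of `e₀` turns `H₁ p.1 = H₂ p.2` on the ranges back into equality in `S₀`. The
  -- complement of the range is thus a union of two analytic sets and a Borel set.
  have hrange : range e =
      (Prod.fst ⁻¹' (range e₁)ᶜ ∪ Prod.snd ⁻¹' (range e₂)ᶜ ∪ {p | H₁ p.1 = H₂ p.2}ᶜ)ᶜ := by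
    ext ⟨y₁, y₂⟩
    simp only [mem_compl_iff, mem_union, mem_preimage, not_or, not_not, mem_ofPred_eq]
    constructor
    · rintro ⟨t, ht⟩
      obtain ⟨rfl, rfl⟩ := Prod.ext_iff.1 ht
      refine ⟨⟨mem_range_self _, mem_range_self _⟩, ?_⟩
      exact (congrFun hH₁ _).symm.trans ((congrArg e₀ t.2).trans (congrFun hH₂ _))
    · rintro ⟨⟨⟨x₁, rfl⟩, x₂, rfl⟩, hx⟩
      exact ⟨⟨(x₁, x₂), inj₀ ((congrFun hH₁ _).trans (hx.trans (congrFun hH₂ _).symm))⟩, rfl⟩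
  have hmE : MeasurableSet {p : Y₁ × Y₂ | H₁ p.1 = H₂ p.2} :=
    measurableSet_eq_fun (mH₁.comp measurable_fst) (mH₂.comp measurable_snd)
  have hco : AnalyticSet (range e)ᶜ := by
    rw [hrange, compl_compl]
    have hu : ∀ {A B : Set (Y₁ × Y₂)}, AnalyticSet A → AnalyticSet B → AnalyticSet (A ∪ B) := by
      intro A B hA hB
      rw [union_eq_iUnion]
      exact AnalyticSet.iUnion (Bool.forall_bool.2 ⟨hB, hA⟩)
    exact hu (hu (hA₁.preimage continuous_fst) (hA₂.preimage continuous_snd))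
      hmE.compl.analyticSet
  have hτ : ∀ a : L, ∃ η : Kernel (FiberProd h₁ h₂) (FiberProd h₁ h₂),
      (∀ t Q, MeasurableSet Q → η t ((fun t => t.1.1) ⁻¹' Q) = S₁.τ a t.1.1 Q) ∧
      (∀ t Q, MeasurableSet Q → η t ((fun t => t.1.2) ⁻¹' Q) = S₂.τ a t.1.2 Q) := by
    intro a
    let κ₁ := ((S₁.τ a).comap _ (measurable_left h₁ h₂)).map e₁
    let κ₂ := ((S₂.τ a).comap _ (measurable_right h₁ h₂)).map e₂
    have hκ₁ : ∀ t, κ₁ t = (S₁.τ a t.1.1).map e₁ := fun t => by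
      rw [Kernel.map_apply _ me₁, Kernel.comap_apply]
    have hκ₂ : ∀ t, κ₂ t = (S₂.τ a t.1.2).map e₂ := fun t => by
      rw [Kernel.map_apply _ me₂, Kernel.comap_apply]
    obtain ⟨ρ, hρ₁, hρ₂, hρ⟩ := Kernel.exists_coupling_of_map_eq κ₁ κ₂ mH₁ mH₂ (by
      ext1 t
      rw [Kernel.map_apply _ mH₁, Kernel.map_apply _ mH₂, hκ₁, hκ₂, Measure.map_map mH₁ me₁,
        Measure.map_map mH₂ me₂, ← hH₁, ← hH₂, ← Measure.map_map me₀ h₁.measurable,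
        ← Measure.map_map me₀ h₂.measurable, h₁.map_τ, h₂.map_τ, t.2])
    have hρ₁' : ∀ t, (ρ t).map Prod.fst = (S₁.τ a t.1.1).map e₁ := fun t => by
      rw [← Kernel.map_apply _ measurable_fst, hρ₁, hκ₁]
    have hρ₂' : ∀ t, (ρ t).map Prod.snd = (S₂.τ a t.1.2).map e₂ := fun t => by
      rw [← Kernel.map_apply _ measurable_snd, hρ₂, hκ₂]
    obtain ⟨η, hη⟩ := Kernel.exists_lift inj hm ρ fun t => by
      have n₁ : ∀ᵐ p ∂ρ t, p.1 ∈ range e₁ := by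
        refine ae_of_ae_map (p := (· ∈ range e₁)) measurable_fst.aemeasurable ?_
        rw [hρ₁']
        exact hA₁.measure_map_eq_zero me₁ _ disjoint_compl_right
      have n₂ : ∀ᵐ p ∂ρ t, p.2 ∈ range e₂ := by
        refine ae_of_ae_map (p := (· ∈ range e₂)) measurable_snd.aemeasurable ?_
        rw [hρ₂']
        exact hA₂.measure_map_eq_zero me₂ _ disjoint_compl_right
      filter_upwards [n₁, n₂, hρ t] with p hp₁ hp₂ hp
      rw [hrange]
      simp [hp₁, hp₂, hp]
    refine ⟨η, fun t Q hQ => ?_, fun t Q hQ => ?_⟩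
    · rw [hm₁] at hQ
      obtain ⟨B, hB, rfl⟩ := hQ
      rw [← Measure.map_apply me₁ hB, ← hρ₁', Measure.map_apply measurable_fst hB,
        ← hη t _ (measurable_fst hB)]
      rfl
    · rw [hm₂] at hQ
      obtain ⟨B, hB, rfl⟩ := hQ
      rw [← Measure.map_apply me₂ hB, ← hρ₂', Measure.map_apply measurable_snd hB,
        ← hη t _ (measurable_snd hB)]
      rfl
  choose τ hτ₁ hτ₂ using hτ
  refine ⟨⟨FiberProd h₁ h₂, τ, fun a t => ?_⟩, isCoanalyticMeasurableSpace_iff.2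
    ⟨Y₁ × Y₂, inferInstance, inferInstance, inferInstance, inferInstance, e, inj, hm, hco⟩,
    ⟨fun t => t.1.1, measurable_left h₁ h₂, fun s => ?_, hτ₁⟩,
    ⟨fun t => t.1.2, measurable_right h₁ h₂, fun s => ?_, hτ₂⟩, funext fun t => t.2⟩
  · exact (hτ₁ a t univ MeasurableSet.univ).trans_le (S₁.le_one a _)
  · obtain ⟨s', hs'⟩ := h₂.surjective (h₁.toFun s)
    exact ⟨⟨(s, s'), hs'.symm⟩, rfl⟩
  · obtain ⟨s', hs'⟩ := h₁.surjective (h₂.toFun s)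
    exact ⟨⟨(s', s), hs'⟩, rfl⟩

end LMP

theorem HasSemipullbacks.bisimilar {C : Type w} [Category.{v} C] (hC : HasSemipullbacks C)
    {S S' : C} : BehaviorallyEquivalent S S' → Bisimilar S S' := by
  rintro ⟨U, ⟨f⟩, ⟨g⟩⟩
  obtain ⟨T, k₁, k₂, -⟩ := hC S U S' f g
  exact ⟨T, ⟨k₁⟩, ⟨k₂⟩⟩

theorem mainTheorem4 (L : Type v) :
    HasSemipullbacks (CoanalyticLMP.{u, v} L) ∧
      ∀ S S' : CoanalyticLMP.{u, v} L, BehaviorallyEquivalent S S' → Bisimilar S S' := by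
  have h : HasSemipullbacks (CoanalyticLMP.{u, v} L) := by
    intro S₁ S₀ S₂ h₁ h₂
    obtain ⟨S₃, c₃, k₁, k₂, hk⟩ :=
      LMP.exists_semipullback S₁.property S₀.property S₂.property h₁.hom h₂.hom
    refine ⟨⟨S₃, c₃⟩, ObjectProperty.homMk k₁, ObjectProperty.homMk k₂, ?_⟩
    exact InducedCategory.hom_ext (LMP.Zigzag.ext hk)
  exact ⟨h, fun _ _ => h.bisimilar⟩
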